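/- Let $V$ be the universe of sets (with the axiom of choice). There is no class $M$ together with a map $j : V \to M$ such that - $M$ is a transitive class (if $x \in M$ and $y \in x$ then $y \in M$); - $j : (V,\in) \to (M,\in)$ is an elementary embedding: for every first-order formula $\varphi(v_1,\dots,v_n)$ in the language $\{\in\}$ and all sets $a_1,\dots,a_n$, $V \models \varphi(a_1,\dots,a_n)$ if and only if $M \models \varphi(j(a_1),\dots,j(a_n))$; - $j$ moves some ordinal, and for $\mathrm{crit}(j)$, the least ordinal $\kappa$ with $j(\kappa) \neq \kappa$, there is an ordinal $\lambda > \mathrm{crit}(j)$ such that $j(\lambda) = \lambda$ and $j''\lambda = \{ j(\alpha) : \alpha < \lambda \} \in M$. (In the formal version $V$ is Mathlib's type `ZFSet` in an arbitrary type universe, $M$ is an arbitrary subclass of it and $j$ an arbitrary function; neither is required to be definable.) -/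

import Mathlib

universe u

open scoped FirstOrder

namespace SetTheoryEmbedding

/-- The relation symbols of the language of set theory: a single binary symbol `∈`. -/
inductive MemRel : ℕ → Type
  | mem : MemRel 2

/-- The first-order language `{∈}` of set theory. -/
def setLang : FirstOrder.Language.{0, 0} := ⟨fun _ => Empty, MemRel⟩

/-- The universe of sets `(V, ∈)` as a first-order structure. -/
instance universeStructure : setLang.Structure ZFSet.{u} where
  funMap := fun f => Empty.elim f
  RelMap := fun r x => match r, x with
    | MemRel.mem, x => x 0 ∈ x 1

/-- A class `M` of sets as a first-order structure `(M, ∈)`, with the true membership relation. -/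
instance classStructure (M : Set ZFSet.{u}) : setLang.Structure M where
  funMap := fun f => Empty.elim f
  RelMap := fun r x => match r, x with
    | MemRel.mem, x => (x 0 : ZFSet.{u}) ∈ (x 1 : ZFSet.{u})

/-- A class of sets is transitive if it contains every element of each of its elements. -/
def IsTransitiveClass (M : Set ZFSet.{u}) : Prop :=
  ∀ x ∈ M, ∀ y ∈ x, y ∈ M

/-- `κ` is the critical point of `j`: the least (von Neumann) ordinal that `j` moves. -/
def IsCriticalPoint {M : Set ZFSet.{u}} (j : ZFSet.{u} ↪ₑ[setLang] M) (κ : ZFSet.{u}) : Prop :=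
  κ.IsOrdinal ∧ (j κ : ZFSet.{u}) ≠ κ ∧ ∀ α ∈ κ, (j α : ZFSet.{u}) = α

/-- The pointwise image `j''x = {j(y) : y ∈ x}`, a set by replacement. -/
noncomputable def pointwiseImage {M : Set ZFSet.{u}} (j : ZFSet.{u} ↪ₑ[setLang] M)
    (x : ZFSet.{u}) : ZFSet.{u} :=
  @ZFSet.image (fun y => (j y : ZFSet.{u})) (Classical.allZFSetDefinable _) x

theorem mem_pointwiseImage {M : Set ZFSet.{u}} (j : ZFSet.{u} ↪ₑ[setLang] M)
    (x z : ZFSet.{u}) :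
    z ∈ pointwiseImage j x ↔ ∃ y ∈ x, (j y : ZFSet.{u}) = z :=
  @ZFSet.mem_image _ (Classical.allZFSetDefinable _) x z

end SetTheoryEmbedding

/-! ### Absoluteness of Δ₀ predicates and elementarity. -/

namespace SetTheoryEmbedding

open ZFSet FirstOrder FirstOrder.Language

/-! This is Kunen's theorem, by way of `ω`-Jónsson functions. Fix `F`, from `ω`-sequences in `lam`
to `lam`, attaining every value on the sequences from each large `A ⊆ lam` (`exists_isJonsson`). By
elementarity `j F` has the corresponding property for the large sets in `j (powerset lam)`, and
`j''lam` is one of them, so `j F` takes the value `κ` at some `s : ω → j''lam`. As `j` fixes `ω` and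
its elements, `s = j t` (`exists_map_eq_of_isFunc`). Hence `κ = (j F)(j t) = j (F t)`, against
`IsCriticalPoint.map_ne`.

"Large" means having no strictly increasing map into an ordinal below `lam`. This can be stated with
bounded quantifiers, and it implies full cardinality (`exists_isStrictMonoRel`), so the Erdős–Hajnal
theorem `exists_omegaJonsson` applies even if `lam` is not a cardinal. -/

/-- A predicate on tuples of sets is absolute for the class `M` if some formula of set theory
defines it both in the universe and in `M`. -/
def Absolute (M : Set ZFSet.{u}) {Γ : Type} (P : (Γ → ZFSet.{u}) → Prop) : Prop :=
  ∃ φ : setLang.Formula Γ, (∀ v : Γ → ZFSet.{u}, φ.Realize v ↔ P v) ∧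
    ∀ w : Γ → M, φ.Realize w ↔ P fun i => w i

namespace Absolute

variable {M : Set ZFSet.{u}} {Γ : Type} {P Q : (Γ → ZFSet.{u}) → Prop}

/-- The membership symbol of the language of set theory. -/
def memSymbol : setLang.Relations 2 := MemRel.mem

/-- The formula `a ∈ b`. -/
def memFormula (a b : Γ) : setLang.Formula Γ :=
  memSymbol.formula₂ (.var a) (.var b)

theorem realize_memFormula (a b : Γ) (v : Γ → ZFSet.{u}) :
    (memFormula a b).Realize v ↔ v a ∈ v b :=
  Formula.realize_rel₂

theorem realize_memFormula_class (a b : Γ) (w : Γ → M) :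
    (memFormula a b).Realize w ↔ (w a : ZFSet.{u}) ∈ (w b : ZFSet.{u}) :=
  Formula.realize_rel₂

theorem mem (a b : Γ) : Absolute M fun v => v a ∈ v b :=
  ⟨memFormula a b, realize_memFormula a b, realize_memFormula_class a b⟩

theorem eq (a b : Γ) : Absolute M fun v => v a = v b :=
  ⟨Term.equal (.var a) (.var b), fun v => by simp, fun w => by simp [Subtype.ext_iff]⟩

theorem not (hP : Absolute M P) : Absolute M fun v => ¬ P v := by
  obtain ⟨φ, h, h'⟩ := hP
  exact ⟨φ.not, fun v => by simp [h], fun w => by simp [h']⟩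

theorem imp (hP : Absolute M P) (hQ : Absolute M Q) : Absolute M fun v => P v → Q v := by
  obtain ⟨φ, h, h'⟩ := hP
  obtain ⟨ψ, k, k'⟩ := hQ
  exact ⟨φ.imp ψ, fun v => by simp [h, k], fun w => by simp [h', k']⟩

theorem congr (hP : Absolute M P) (h : ∀ v, Q v ↔ P v) : Absolute M Q := by
  rwa [show Q = P from funext fun v => propext (h v)]

theorem and (hP : Absolute M P) (hQ : Absolute M Q) : Absolute M fun v => P v ∧ Q v :=
  (hP.imp hQ.not).not.congr fun v => by tauto

theorem or (hP : Absolute M P) (hQ : Absolute M Q) : Absolute M fun v => P v ∨ Q v :=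
  (hP.not.imp hQ).congr fun v => by tauto

/-- Transitivity of `M` enters here: a set in `M` has the same elements in `M` as in `V`. -/
theorem ball (hM : IsTransitiveClass M) (a : Γ) {R : (Γ → ZFSet.{u}) → ZFSet.{u} → Prop}
    (hR : Absolute M fun w : Γ ⊕ Unit → ZFSet.{u} => R (fun i => w (.inl i)) (w (.inr ()))) :
    Absolute M fun v => ∀ x ∈ v a, R v x := by
  obtain ⟨φ, h, h'⟩ := hR
  refine ⟨((memFormula (.inr ()) (.inl a)).imp φ).iAlls Unit, fun v => ?_, fun w => ?_⟩
  · simp only [Formula.realize_iAlls, Formula.realize_imp, realize_memFormula, h, Sum.elim_inl,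
      Sum.elim_inr]
    exact ⟨fun H x => H fun _ => x, fun H i => H _⟩
  · simp only [Formula.realize_iAlls, Formula.realize_imp, realize_memFormula_class, h',
      Sum.elim_inl, Sum.elim_inr]
    exact ⟨fun H x hx => H (fun _ => ⟨x, hM _ (w a).2 x hx⟩) hx, fun H i => H _⟩

theorem bex (hM : IsTransitiveClass M) (a : Γ) {R : (Γ → ZFSet.{u}) → ZFSet.{u} → Prop}
    (hR : Absolute M fun w : Γ ⊕ Unit → ZFSet.{u} => R (fun i => w (.inl i)) (w (.inr ()))) :
    Absolute M fun v => ∃ x ∈ v a, R v x :=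
  (ball hM a (R := fun v x => ¬ R v x) hR.not).not.congr fun v => by push Not; rfl

theorem subset (hM : IsTransitiveClass M) (a b : Γ) : Absolute M fun v => v a ⊆ v b :=
  congr (P := fun v => ∀ x ∈ v a, x ∈ v b) (ball hM _ (mem _ _)) fun _ => Iff.rfl

theorem eq_empty (hM : IsTransitiveClass M) (a : Γ) : Absolute M fun v => v a = ∅ :=
  congr (P := fun v => ∀ x ∈ v a, ¬ x = x) (ball hM _ (eq _ _).not) fun v => by
    simp [ZFSet.eq_empty]

theorem eq_insert_self (hM : IsTransitiveClass M) (a b : Γ) :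
    Absolute M fun v => v a = insert (v b) (v b) :=
  congr (P := fun v => (∀ x ∈ v a, x = v b ∨ x ∈ v b) ∧ v b ∈ v a ∧ v b ⊆ v a)
    ((ball hM _ ((eq _ _).or (mem _ _))).and ((mem _ _).and (subset hM _ _))) fun v => by
    constructor
    · intro h
      simp only [h, mem_insert_iff, imp_self, implies_true, true_or, true_and]
      exact fun x hx => mem_insert_iff.2 (.inr hx)
    · rintro ⟨h, hb, hs⟩
      ext x
      rw [mem_insert_iff]
      exact ⟨h x, fun hx => hx.elim (fun e => e ▸ hb) fun e => hs e⟩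

theorem eq_unordered_pair (hM : IsTransitiveClass M) (a b c : Γ) :
    Absolute M fun v => v a = {v b, v c} :=
  congr (P := fun v => (∀ x ∈ v a, x = v b ∨ x = v c) ∧ v b ∈ v a ∧ v c ∈ v a)
    ((ball hM _ ((eq _ _).or (eq _ _))).and ((mem _ _).and (mem _ _))) fun v => by
    constructor
    · intro h; simp [h]
    · rintro ⟨h, hb, hc⟩
      ext x
      rw [mem_pair]
      exact ⟨h x, fun hx => hx.elim (fun e => e ▸ hb) fun e => e ▸ hc⟩

theorem eq_pair (hM : IsTransitiveClass M) (a b c : Γ) :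
    Absolute M fun v => v a = pair (v b) (v c) :=
  congr (P := fun v => ∃ x ∈ v a, x = {v b, v b} ∧ ∃ y ∈ v a, y = {v b, v c} ∧ v a = {x, y})
    (bex hM _ ((eq_unordered_pair hM _ _ _).and (bex hM _
      ((eq_unordered_pair hM _ _ _).and (eq_unordered_pair hM _ _ _))))) fun v => by
    constructor
    · intro h
      exact ⟨{v b, v b}, by simp [h, pair], rfl, {v b, v c}, by simp [h, pair], rfl,
        by simp [h, pair]⟩
    · rintro ⟨x, -, rfl, y, -, rfl, h⟩
      simp [h, pair]

theorem pair_mem (hM : IsTransitiveClass M) (a b c : Γ) :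
    Absolute M fun v => pair (v a) (v b) ∈ v c :=
  congr (P := fun v => ∃ p ∈ v c, p = pair (v a) (v b)) (bex hM _ (eq_pair hM _ _ _))
    fun v => by simp

theorem isFunc (hM : IsTransitiveClass M) (a b f : Γ) :
    Absolute M fun v => IsFunc (v a) (v b) (v f) :=
  congr (P := fun v => (∀ p ∈ v f, ∃ x ∈ v a, ∃ y ∈ v b, p = pair x y) ∧
      ∀ x ∈ v a, ∃ y ∈ v b, pair x y ∈ v f ∧ ∀ z ∈ v b, pair x z ∈ v f → z = y)
    ((ball hM _ (bex hM _ (bex hM _ (eq_pair hM _ _ _)))).and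
      (ball hM _ (bex hM _ ((pair_mem hM _ _ _).and
        (ball hM _ ((pair_mem hM _ _ _).imp (eq _ _)))))))
    fun v => by
    simp only [IsFunc, subset_def, mem_prod]
    refine and_congr_right fun h => forall₂_congr fun x hx => ?_
    -- Values lie in the codomain anyway, so bounding the quantifiers loses nothing.
    have hb : ∀ y, pair x y ∈ v f → y ∈ v b := fun y hy => by
      obtain ⟨p, -, q, hq, e⟩ := h hy
      rwa [(pair_injective e).2]
    exact ⟨fun ⟨y, hy, hu⟩ => ⟨y, hb y hy, hy, fun z _ hz => hu z hz⟩,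
      fun ⟨y, _, hy, hu⟩ => ⟨y, hy, fun z hz => hu z (hb z hz) hz⟩⟩

theorem map_iff (hP : Absolute M P) (j : ZFSet.{u} ↪ₑ[setLang] M) (v : Γ → ZFSet.{u}) :
    P (fun i => j (v i)) ↔ P v := by
  obtain ⟨φ, h, h'⟩ := hP
  exact (h' _).symm.trans ((j.map_formula φ v).trans (h v))

/-- Elementarity for a universally quantified absolute predicate. -/
theorem map_forall {R : (Γ → ZFSet.{u}) → ZFSet.{u} → Prop}
    (hR : Absolute M fun w : Γ ⊕ Unit → ZFSet.{u} => R (fun i => w (.inl i)) (w (.inr ())))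
    (j : ZFSet.{u} ↪ₑ[setLang] M) (v : Γ → ZFSet.{u}) (h : ∀ x, R v x) :
    ∀ x ∈ M, R (fun i => j (v i)) x := by
  obtain ⟨φ, h₁, h₂⟩ := hR
  have key : (φ.iAlls Unit).Realize v := by
    simp only [Formula.realize_iAlls, h₁, Sum.elim_inl, Sum.elim_inr]
    exact fun i => h _
  rw [← j.map_formula] at key
  simp only [Formula.realize_iAlls, h₂, Sum.elim_inl, Sum.elim_inr] at key
  exact fun x hx => key fun _ => ⟨x, hx⟩

end Absolute
end SetTheoryEmbedding

universe v

/-! ### The Erdős–Hajnal theorem. -/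

namespace SetTheoryEmbedding
open Cardinal

/-- A map recovering, from some tail of each injective sequence, the term preceding that tail. -/
theorem exists_predict_previous_term (X : Type v) [Nonempty X] :
    ∃ f : (ℕ → X) → X, ∀ s : ℕ → X, Function.Injective s →
      ∃ m, f (fun k => s (m + 1 + k)) = s m := by
  classical
  -- Tail equivalence up to a shift; `f` locates its argument as a tail of the chosen representative
  -- and returns the preceding term.
  let S : Setoid (ℕ → X) :=
    { r := fun s t => ∃ m n, ∀ k, s (m + k) = t (n + k)
      iseqv := by
        refine ⟨fun s => ⟨0, 0, fun _ => rfl⟩, fun ⟨m, n, h⟩ => ⟨n, m, fun k => (h k).symm⟩, ?_⟩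
        rintro s t r ⟨m, n, h⟩ ⟨p, q, h'⟩
        refine ⟨m + p, q + n, fun k => ?_⟩
        rw [add_assoc, h, add_left_comm, h', add_assoc] }
  let rep : (ℕ → X) → ℕ → X := fun s => (Quotient.mk S s).out
  refine ⟨fun t => if h : ∃ p, ∀ k, t k = rep t (p + 1 + k) then rep t h.choose
    else Classical.arbitrary X, fun s hs => ?_⟩
  obtain ⟨p, m, h⟩ : ∃ p m, ∀ k, rep s (p + k) = s (m + k) :=
    Quotient.exact (Quotient.out_eq (Quotient.mk S s))
  refine ⟨m, ?_⟩
  have hrep : rep (fun k => s (m + 1 + k)) = rep s := by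
    refine congrArg Quotient.out (Quotient.sound (s := S) ⟨0, m + 1, fun k => ?_⟩)
    simp
  have hex : ∃ p, ∀ k, s (m + 1 + k) = rep s (p + 1 + k) :=
    ⟨p, fun k => by rw [add_assoc p, h, add_assoc]⟩
  simp only [hrep]
  rw [dif_pos hex]
  have hq := hex.choose_spec
  set q := hex.choose
  -- Injectivity of `s` leaves only one possible position in the representative.
  have hqp : q = p := by
    have h1 := hq p
    have h2 := h (q + 1)
    rw [show q + 1 + p = p + (q + 1) by ring, h2] at h1
    have := hs h1
    omega
  rw [hqp]
  simpa using h 0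

/-- The Erdős–Hajnal theorem: every infinite type carries an `ω`-Jónsson function. -/
theorem exists_omegaJonsson (X : Type v) [Infinite X] :
    ∃ F : (ℕ → X) → X, ∀ B : Set X, #B = #X → ∀ x, ∃ s : ℕ → X, (∀ n, s n ∈ B) ∧ F s = x := by
  classical
  obtain ⟨f, hf⟩ := exists_predict_previous_term X
  obtain ⟨A, hA, hAf⟩ : ∃ A : Set X, #A = #X ∧ ∀ B ⊆ A, #B = #X →
      ∀ a ∈ A, ∃ s : ℕ → X, (∀ n, s n ∈ B) ∧ f s = a := by
    by_contra! H
    -- Deleting the omitted value `a` from `B` makes the values met along the iteration distinct;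
    -- `f` must then predict one of them from its tail, a contradiction.
    have H' : ∀ A : {A : Set X // #A = #X}, ∃ B : {A : Set X // #A = #X}, ∃ a ∈ A.1,
        B.1 ⊆ A.1 ∧ a ∉ B.1 ∧ ∀ s : ℕ → X, (∀ n, s n ∈ B.1) → f s ≠ a := by
      rintro ⟨A, hA⟩
      obtain ⟨B, hBA, hB, a, ha, h⟩ := H A hA
      refine ⟨⟨B \ {a}, ?_⟩, a, ha, fun x hx => hBA hx.1, fun h => h.2 rfl,
        fun s hs => h s fun n => (hs n).1⟩
      have hBinf : ℵ₀ ≤ #B := hB ▸ aleph0_le_mk X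
      rw [← hB]
      refine le_antisymm (mk_le_mk_of_subset Set.sdiff_subset) ?_
      by_contra! hlt
      have h1 : #B ≤ #(B \ {a} : Set X) + #({a} : Set X) := by
        refine (mk_le_mk_of_subset ?_).trans (mk_union_le _ _)
        intro x hx
        by_cases e : x = a <;> simp [hx, e]
      exact absurd (add_lt_of_lt hBinf hlt
        (by rw [mk_singleton]; exact one_lt_aleph0.trans_le hBinf)) h1.not_gt
    choose N a ha hN haN hfN using H'
    let A : ℕ → {A : Set X // #A = #X} := fun n => N^[n] ⟨Set.univ, mk_univ⟩
    have hsucc : ∀ n, A (n + 1) = N (A n) := fun n => Function.iterate_succ_apply' _ _ _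
    have hanti : Antitone fun n => (A n).1 := antitone_nat_of_succ_le fun n => by
      rw [hsucc]; exact hN _
    have hlt : ∀ m n, m < n → a (A n) ∈ (N (A m)).1 := fun m n h => by
      rw [← hsucc]; exact hanti (Nat.succ_le_of_lt h) (ha _)
    have hinj : Function.Injective fun n => a (A n) := by
      intro m n h
      by_contra hne
      rcases lt_or_gt_of_ne hne with hl | hl
      · exact haN (A m) ((show a (A m) = a (A n) from h) ▸ hlt m n hl)
      · exact haN (A n) ((show a (A m) = a (A n) from h) ▸ hlt n m hl)
    obtain ⟨m, hm⟩ := hf _ hinj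
    exact hfN (A m) _ (fun k => hlt m _ (by omega)) hm
  obtain ⟨e⟩ := Cardinal.eq.1 hA
  refine ⟨fun s => if h : f (fun n => e.symm (s n)) ∈ A then e ⟨_, h⟩ else Classical.arbitrary X,
    fun B hB x => ?_⟩
  obtain ⟨s, hs, hfs⟩ := hAf ((fun b => (e.symm b : X)) '' B) (by rintro _ ⟨b, -, rfl⟩; simp)
    ((mk_image_eq (Subtype.val_injective.comp e.symm.injective)).trans hB) (e.symm x)
    (Subtype.prop _)
  choose b hb hbs using hs
  refine ⟨b, hb, ?_⟩
  simp [hbs, hfs]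

end SetTheoryEmbedding

/-! ### Jónsson functions as sets. -/

namespace SetTheoryEmbedding

open ZFSet Cardinal

/-- The `n`-th finite von Neumann ordinal. -/
noncomputable def numeral (n : ℕ) : ZFSet.{u} := (n : Ordinal.{u}).toZFSet

theorem numeral_injective : Function.Injective numeral.{u} :=
  Ordinal.toZFSet_injective.comp Nat.cast_injective

theorem numeral_zero : numeral.{u} 0 = ∅ := by simp [numeral]

theorem numeral_succ (n : ℕ) : numeral.{u} (n + 1) = insert (numeral n) (numeral n) := by
  simp [numeral, Ordinal.toZFSet_add_one]

/-- The set of finite von Neumann ordinals. -/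
noncomputable def numerals : ZFSet.{u} := ZFSet.range numeral

theorem mem_numerals {x : ZFSet.{u}} : x ∈ numerals ↔ ∃ n, numeral n = x := by
  simp [numerals]

/-- `f` relates every element of `A` to some element of `μ`, in a strictly increasing way with
respect to membership. -/
def IsStrictMonoRel (f A μ : ZFSet.{u}) : Prop :=
  (∀ a ∈ A, ∃ β ∈ μ, pair a β ∈ f) ∧
    ∀ a ∈ A, ∀ b ∈ A, ∀ β ∈ μ, ∀ γ ∈ μ, pair a β ∈ f → pair b γ ∈ f → a ∈ b → β ∈ γ

/-- `F` is an `ω`-Jónsson function for the ordinal `lam`: it attains every value on the sequences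
in any `A ∈ P` that has no strictly increasing map (among those in `R`) to an ordinal below `lam`.
Here `N` is the index set of sequences and `W` the set of sequences. -/
def IsJonsson (P R W N lam F : ZFSet.{u}) : Prop :=
  ∀ A ∈ P, (∀ μ ∈ lam, ∀ f ∈ R, ¬ IsStrictMonoRel f A μ) →
    ∀ ξ ∈ lam, ∃ s ∈ W, IsFunc N A s ∧ pair s ξ ∈ F

theorem Absolute.isStrictMonoRel {M : Set ZFSet.{u}} {Γ : Type} (hM : IsTransitiveClass M)
    (f A μ : Γ) : Absolute M fun v => IsStrictMonoRel (v f) (v A) (v μ) :=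
  (ball hM _ (bex hM _ (pair_mem hM _ _ _))).and
    (ball hM _ (ball hM _ (ball hM _ (ball hM _
      ((pair_mem hM _ _ _).imp ((pair_mem hM _ _ _).imp ((mem _ _).imp (mem _ _))))))))

/-- Powersets and sets of sequences need not be absolute; as parameters they simply move with `j`,
and all quantifiers stay bounded. -/
theorem Absolute.isJonsson {M : Set ZFSet.{u}} {Γ : Type} (hM : IsTransitiveClass M)
    (P R W N lam F : Γ) :
    Absolute M fun v => IsJonsson (v P) (v R) (v W) (v N) (v lam) (v F) :=
  ball hM _ ((ball hM _ (ball hM _ (isStrictMonoRel hM _ _ _).not)).imp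
    (ball hM _ (bex hM _ ((isFunc hM _ _ _).and (pair_mem hM _ _ _)))))

theorem isFunc_eq_of_pair_mem {N A B s t : ZFSet.{u}} (hs : IsFunc N A s) (ht : IsFunc N B t)
    (h : ∀ n ∈ N, ∃ w, pair n w ∈ s ∧ pair n w ∈ t) : s = t := by
  have key : ∀ {A B s t : ZFSet.{u}}, IsFunc N A s → IsFunc N B t →
      (∀ n ∈ N, ∃ w, pair n w ∈ s ∧ pair n w ∈ t) → s ⊆ t := by
    intro A B s t hs ht h z hz
    obtain ⟨n, hn, w, -, rfl⟩ := mem_prod.1 (hs.1 hz)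
    obtain ⟨w', h1, h2⟩ := h n hn
    rwa [(hs.2 n hn).unique hz h1]
  exact subset_antisymm (key hs ht h) (key ht hs fun n hn => (h n hn).imp fun _ h => h.symm)

theorem isFunc_mono {N A B s : ZFSet.{u}} (hs : IsFunc N A s) (h : A ⊆ B) : IsFunc N B s :=
  ⟨fun z hz => by
    obtain ⟨n, hn, w, hw, rfl⟩ := mem_prod.1 (hs.1 hz)
    exact pair_mem_prod.2 ⟨hn, h hw⟩, hs.2⟩

/-- A subset of an ordinal that has smaller cardinality embeds into a proper initial segment. -/
theorem exists_isStrictMonoRel {lam A : ZFSet.{u}} (hlam : lam.IsOrdinal) (hA : A ⊆ lam)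
    (hcard : #{x : {x // x ∈ lam} | x.1 ∈ A} ≠ #{x // x ∈ lam}) :
    ∃ μ ∈ lam, ∃ f ∈ powerset (prod lam lam), IsStrictMonoRel f A μ := by
  let r : {x // x ∈ lam} → {x // x ∈ lam} → Prop := Subrel (· ∈ ·) (· ∈ lam)
  have : IsWellOrder _ r := hlam.isWellOrder
  let B : Set {x // x ∈ lam} := {x | x.1 ∈ A}
  let rB : B → B → Prop := Subrel r (· ∈ B)
  rcases lt_or_ge (Ordinal.type rB) (Ordinal.type r) with h | h
  · obtain ⟨g⟩ := Ordinal.type_lt_iff.1 h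
    refine ⟨g.top.1, g.top.2,
      (prod lam lam).sep fun p => ∃ b : B, p = pair b.1.1 (g b).1, ?_, ?_, ?_⟩
    · exact mem_powerset.2 sep_subset
    · intro a ha
      exact ⟨(g ⟨⟨a, hA ha⟩, ha⟩).1, g.lt_top _, mem_sep.2
        ⟨pair_mem_prod.2 ⟨hA ha, Subtype.prop _⟩, ⟨⟨⟨a, hA ha⟩, ha⟩, rfl⟩⟩⟩
    · intro a _ b _ β _ γ _ h1 h2 hab
      obtain ⟨-, a', e1⟩ := mem_sep.1 h1
      obtain ⟨-, b', e2⟩ := mem_sep.1 h2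
      obtain ⟨rfl, rfl⟩ := pair_injective e1
      obtain ⟨rfl, rfl⟩ := pair_injective e2
      exact g.toRelEmbedding.map_rel_iff.2 hab
  · obtain ⟨g⟩ := Ordinal.type_le_iff.1 h
    exact absurd (le_antisymm (mk_set_le B) (mk_le_of_injective g.injective)) hcard

/-- A strictly increasing map from a set of ordinals to itself has no value below its argument. -/
theorem not_mem_of_strictMono {lam : ZFSet.{u}} {h : ZFSet.{u} → ZFSet.{u}}
    (hmaps : ∀ x ∈ lam, h x ∈ lam) (hmono : ∀ x ∈ lam, ∀ y ∈ lam, x ∈ y → h x ∈ h y) :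
    ∀ x ∈ lam, h x ∉ x := by
  intro x
  induction x using ZFSet.inductionOn with
  | h x ih =>
    -- If `h x ∈ x`, then `h (h x) ∈ h x`: a smaller counterexample.
    exact fun hx hlt => ih _ hlt (hmaps x hx) (hmono _ (hmaps x hx) _ hx hlt)

/-- Every infinite ordinal carries an `ω`-Jónsson function. -/
theorem exists_isJonsson {lam : ZFSet.{u}} (hlam : lam.IsOrdinal) [Infinite {x // x ∈ lam}] :
    ∃ F : ZFSet.{u}, IsFunc (funs numerals lam) lam F ∧
      IsJonsson (powerset lam) (powerset (prod lam lam)) (funs numerals lam) numerals lam F := by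
  classical
  obtain ⟨Φ, hΦ⟩ := exists_omegaJonsson {x // x ∈ lam}
  let decode : ZFSet.{u} → ℕ → {x // x ∈ lam} := fun s n =>
    if h : ∃ w : {x // x ∈ lam}, pair (numeral n) w.1 ∈ s then h.choose else Classical.arbitrary _
  let G : ZFSet.{u} → ZFSet.{u} := fun s => (Φ (decode s)).1
  let := fun {n} (F : (Fin n → ZFSet.{u}) → ZFSet.{u}) => Classical.allZFSetDefinable F
  refine ⟨map G (funs numerals lam), map_isFunc.2 fun _ _ => Subtype.prop _,
    fun A hA hlarge ξ hξ => ?_⟩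
  rw [mem_powerset] at hA
  have hB : #{x : {x // x ∈ lam} | x.1 ∈ A} = #{x // x ∈ lam} := by
    by_contra hne
    obtain ⟨μ, hμ, f, hf, h⟩ := exists_isStrictMonoRel hlam hA hne
    exact hlarge μ hμ f hf h
  obtain ⟨s, hs, hsξ⟩ := hΦ _ hB ⟨ξ, hξ⟩
  let g : ZFSet.{u} → ZFSet.{u} := fun x => (s (Function.invFun numeral x)).1
  have hg : ∀ n, g (numeral n) = (s n).1 := fun n => by
    simp only [g, Function.leftInverse_invFun numeral_injective n]
  have hS : IsFunc numerals A (map g numerals) := map_isFunc.2 fun _ _ => hs _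
  have hSW : map g numerals ∈ funs numerals lam := mem_funs.2 (isFunc_mono hS hA)
  have hdec : decode (map g numerals) = s := by
    funext n
    have hn : ∀ w, pair (numeral n) w ∈ map g numerals ↔ w = (s n).1 := by
      intro w
      rw [mem_map]
      constructor
      · rintro ⟨z, -, e⟩
        obtain ⟨rfl, rfl⟩ := pair_injective e
        exact hg n
      · rintro rfl
        exact ⟨numeral n, mem_numerals.2 ⟨n, rfl⟩, by rw [hg]⟩
    have hex : ∃ w : {x // x ∈ lam}, pair (numeral n) w.1 ∈ map g numerals := ⟨s n, (hn _).2 rfl⟩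
    simp only [decode]
    rw [dif_pos hex]
    exact Subtype.ext ((hn _).1 hex.choose_spec)
  refine ⟨_, hSW, hS, mem_map.2 ⟨_, hSW, ?_⟩⟩
  simp only [G, hdec, hsξ]

/-! ### Action of `j` on numerals, subsets and sequences. -/

section Embedding

variable {M : Set ZFSet.{u}} (j : ZFSet.{u} ↪ₑ[setLang] M)

theorem map_mem_iff {x y : ZFSet.{u}} : (j x : ZFSet.{u}) ∈ (j y : ZFSet.{u}) ↔ x ∈ y :=
  (Absolute.mem (M := M) (0 : Fin 2) 1).map_iff j ![x, y]

theorem map_inj {x y : ZFSet.{u}} : (j x : ZFSet.{u}) = j y ↔ x = y :=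
  Subtype.ext_iff.symm.trans j.injective.eq_iff

theorem map_pair_mem_iff (hM : IsTransitiveClass M) {a b c : ZFSet.{u}} :
    pair (j a) (j b) ∈ (j c : ZFSet.{u}) ↔ pair a b ∈ c :=
  (Absolute.pair_mem hM (0 : Fin 3) 1 2).map_iff j ![a, b, c]

theorem map_isFunc_iff (hM : IsTransitiveClass M) {a b f : ZFSet.{u}} :
    IsFunc (j a) (j b) (j f) ↔ IsFunc a b f :=
  (Absolute.isFunc hM (0 : Fin 3) 1 2).map_iff j ![a, b, f]

theorem map_numeral (hM : IsTransitiveClass M) (n : ℕ) : (j (numeral n) : ZFSet.{u}) = numeral n := by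
  induction n with
  | zero =>
    rw [numeral_zero]
    exact ((Absolute.eq_empty hM (0 : Fin 1)).map_iff j ![∅]).2 rfl
  | succ n ih =>
    have h : (j (numeral (n + 1)) : ZFSet.{u}) =
        insert (j (numeral n) : ZFSet.{u}) (j (numeral n) : ZFSet.{u}) :=
      ((Absolute.eq_insert_self hM (0 : Fin 2) 1).map_iff j ![numeral (n + 1), numeral n]).2
        (numeral_succ n)
    rw [h, ih, numeral_succ]

/-- By elementarity each element of `j numerals` is empty or the successor of another element, so
`∈`-induction leaves only numerals. -/
theorem map_numerals (hM : IsTransitiveClass M) : (j numerals : ZFSet.{u}) = numerals := by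
  have h : ∀ x ∈ (j numerals : ZFSet.{u}),
      x = ∅ ∨ ∃ y ∈ (j numerals : ZFSet.{u}), x = insert y y := by
    refine ((Absolute.ball hM (0 : Fin 1) (R := fun v x => x = ∅ ∨ ∃ y ∈ v 0, x = insert y y)
      ((Absolute.eq_empty hM _).or (Absolute.bex hM _ (Absolute.eq_insert_self hM _ _)))).map_iff
      j ![numerals]).2 ?_
    intro x hx
    obtain ⟨n, rfl⟩ := mem_numerals.1 hx
    cases n with
    | zero => exact .inl numeral_zero
    | succ n => exact .inr ⟨_, mem_numerals.2 ⟨n, rfl⟩, numeral_succ n⟩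
  refine subset_antisymm (fun x => ?_) fun x hx => ?_
  · induction x using ZFSet.inductionOn with
    | h x ih =>
      intro hx
      rcases h x hx with rfl | ⟨y, hy, rfl⟩
      · exact mem_numerals.2 ⟨0, numeral_zero⟩
      · obtain ⟨n, rfl⟩ := mem_numerals.1 (ih y (mem_insert _ _) hy)
        exact mem_numerals.2 ⟨n + 1, numeral_succ n⟩
  · obtain ⟨n, rfl⟩ := mem_numerals.1 hx
    rw [← map_numeral j hM n, map_mem_iff]
    exact hx

theorem mem_map_powerset (hM : IsTransitiveClass M) {x y : ZFSet.{u}} (hx : x ∈ M)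
    (hxy : x ⊆ j y) :
    x ∈ (j (powerset y) : ZFSet.{u}) :=
  Absolute.map_forall (R := fun v x => x ⊆ v (0 : Fin 2) → x ∈ v 1)
    ((Absolute.subset hM _ _).imp (Absolute.mem _ _)) j ![y, powerset y]
    (fun _ => mem_powerset.2) x hx hxy

/-- A sequence of elements of the pointwise image of `lam` is the image of a sequence in `lam`. -/
theorem exists_map_eq_of_isFunc (hM : IsTransitiveClass M) {lam s : ZFSet.{u}}
    (hs : IsFunc numerals (pointwiseImage j lam) s) :
    ∃ t, IsFunc numerals lam t ∧ (j t : ZFSet.{u}) = s := by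
  -- The sequence `j⁻¹ ∘ s`.
  let t := (prod numerals lam).sep fun p => ∃ n α, p = pair n α ∧ pair n (j α) ∈ s
  have ht : ∀ {n α}, pair n α ∈ t ↔ (n ∈ numerals ∧ α ∈ lam) ∧ pair n (j α : ZFSet.{u}) ∈ s := by
    intro n α
    rw [mem_sep, pair_mem_prod]
    refine and_congr_right fun _ => ⟨?_, fun h => ⟨n, α, rfl, h⟩⟩
    rintro ⟨n', α', e, h⟩
    obtain ⟨rfl, rfl⟩ := pair_injective e
    exact h
  have hval : ∀ n ∈ numerals, ∃ α ∈ lam, pair n (j α : ZFSet.{u}) ∈ s := by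
    intro n hn
    obtain ⟨w, hw, -⟩ := hs.2 n hn
    obtain ⟨α, hα, rfl⟩ := (mem_pointwiseImage j lam w).1 (pair_mem_prod.1 (hs.1 hw)).2
    exact ⟨α, hα, hw⟩
  have htf : IsFunc numerals lam t := by
    refine ⟨sep_subset, fun n hn => ?_⟩
    obtain ⟨α, hα, h⟩ := hval n hn
    exact ⟨α, ht.2 ⟨⟨hn, hα⟩, h⟩, fun β hβ =>
      (map_inj j).1 ((hs.2 n hn).unique (ht.1 hβ).2 h)⟩
  have hjt := (map_isFunc_iff j hM).2 htf
  rw [map_numerals j hM] at hjt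
  refine ⟨t, htf, isFunc_eq_of_pair_mem hjt hs fun n hn => ?_⟩
  obtain ⟨α, hα, h⟩ := hval n hn
  have := (map_pair_mem_iff j hM).2 (ht.2 ⟨⟨hn, hα⟩, h⟩)
  obtain ⟨k, rfl⟩ := mem_numerals.1 hn
  rw [map_numeral j hM] at this
  exact ⟨_, this, h⟩

/-- The critical point is not in the range of the embedding on ordinals. -/
theorem IsCriticalPoint.map_ne {j : ZFSet.{u} ↪ₑ[setLang] M} {κ ξ : ZFSet.{u}}
    (hκ : IsCriticalPoint j κ) (hξ : ξ.IsOrdinal) : (j ξ : ZFSet.{u}) ≠ κ := by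
  obtain ⟨hord, hne, hfix⟩ := hκ
  intro h
  rcases hξ.mem_trichotomous hord with h1 | rfl | h1
  · exact mem_irrefl κ (by rwa [← hfix ξ h1, h] at h1)
  · exact hne h
  · have h2 := (map_mem_iff j).2 h1
    rw [h] at h2
    exact hne ((map_inj j).1 (hfix _ h2))

end Embedding

end SetTheoryEmbedding

/-! ### The contradiction. -/

open SetTheoryEmbedding ZFSet in
/-- There is no elementary embedding `j : V → M` into a transitive class `M` for which some ordinal
`lam` above the critical point of `j` satisfies `j lam = lam` and `j '' lam ∈ M`. -/
theorem mainTheorem1 :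
    ¬ ∃ (M : Set ZFSet.{u}) (j : ZFSet.{u} ↪ₑ[SetTheoryEmbedding.setLang] M)
        (κ lam : ZFSet.{u}),
      SetTheoryEmbedding.IsTransitiveClass M ∧
      SetTheoryEmbedding.IsCriticalPoint j κ ∧
      lam.IsOrdinal ∧ κ ∈ lam ∧
      (j lam : ZFSet.{u}) = lam ∧
      SetTheoryEmbedding.pointwiseImage j lam ∈ M := by
  rintro ⟨M, j, κ, lam, hM, hκ, hlam, hκlam, hjlam, himage⟩
  have hmaps : ∀ α ∈ lam, (j α : ZFSet.{u}) ∈ lam := fun α hα => by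
    have := (map_mem_iff j).2 hα
    rwa [hjlam] at this
  have hsub : ∀ n, numeral n ∈ κ := by
    have hne : ∀ n, numeral n ≠ κ := fun n h => hκ.2.1 (h ▸ map_numeral j hM n)
    intro n
    induction n with
    | zero =>
      rcases isOrdinal_empty.mem_trichotomous hκ.1 with h | h | h
      · rwa [numeral_zero]
      · exact absurd (numeral_zero.trans h) (hne 0)
      · exact absurd h (notMem_empty _)
    | succ n ih =>
      have hsucc := numeral_succ.{u} n
      rcases (isOrdinal_toZFSet ((n + 1 : ℕ) : Ordinal.{u})).mem_trichotomous hκ.1 with h | h | h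
      · exact h
      · exact absurd h (hne _)
      · change κ ∈ numeral (n + 1) at h
        rw [hsucc, mem_insert_iff] at h
        rcases h with h | h
        · exact absurd h.symm (hne n)
        · exact absurd h (mem_asymm ih)
  have : Infinite {x // x ∈ lam} :=
    Infinite.of_injective (fun n => ⟨numeral n, hlam.mem_trans (hsub n) hκlam⟩)
      fun m n h => numeral_injective (Subtype.ext_iff.1 h)
  obtain ⟨F, hF, hJ⟩ := exists_isJonsson hlam
  have hjF := (map_isFunc_iff j hM).2 hF
  have hjJ : IsJonsson _ _ _ _ _ _ := ((Absolute.isJonsson hM (0 : Fin 6) 1 2 3 4 5).map_iff j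
    ![powerset lam, powerset (prod lam lam), funs numerals lam, numerals, lam, F]).2 hJ
  change IsJonsson (j (powerset lam)) (j (powerset (prod lam lam))) (j (funs numerals lam))
    (j numerals) (j lam) (j F) at hjJ
  rw [hjlam, map_numerals j hM] at hjJ
  rw [hjlam] at hjF
  have himlam : pointwiseImage j lam ⊆ lam := fun z hz => by
    obtain ⟨α, hα, rfl⟩ := (mem_pointwiseImage j lam z).1 hz
    exact hmaps α hα
  obtain ⟨s, hsW, hs, hsF⟩ := hjJ (pointwiseImage j lam)
    (mem_map_powerset j hM himage (by rwa [hjlam])) (by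
      -- `j''lam` is large: composing `f` with `j` would map `lam` increasingly into `μ`, sending
      -- `μ` below itself.
      rintro μ hμ f - ⟨h1, h2⟩
      have hj : ∀ α ∈ lam, (j α : ZFSet.{u}) ∈ pointwiseImage j lam := fun α hα =>
        (mem_pointwiseImage j lam _).2 ⟨α, hα, rfl⟩
      have : ∀ α, ∃ β, α ∈ lam → β ∈ μ ∧ pair (j α) β ∈ f := fun α => by
        by_cases hα : α ∈ lam
        · obtain ⟨β, hβ, h⟩ := h1 _ (hj α hα)
          exact ⟨β, fun _ => ⟨hβ, h⟩⟩
        · exact ⟨∅, fun h => absurd h hα⟩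
      choose h hh using this
      exact not_mem_of_strictMono (fun x hx => hlam.mem_trans (hh x hx).1 hμ)
        (fun x hx y hy hxy => h2 _ (hj x hx) _ (hj y hy) _ (hh x hx).1 _ (hh y hy).1
          (hh x hx).2 (hh y hy).2 ((map_mem_iff j).2 hxy)) μ hμ (hh μ hμ).1)
    κ hκlam
  obtain ⟨t, ht, rfl⟩ := exists_map_eq_of_isFunc j hM hs
  obtain ⟨ξ, hξ, -⟩ := hF.2 t (mem_funs.2 ht)
  exact hκ.map_ne (hlam.mem (pair_mem_prod.1 (hF.1 hξ)).2)
    ((hjF.2 _ hsW).unique ((map_pair_mem_iff j hM).2 hξ) hsF)
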